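/- Partisan scoring positional games. Let $H$ be a finite hypergraph (with vertex set $V$) each of whose hyperedges is colored blue, red or green. Two players, Left and Right, alternately claim an unclaimed vertex of $H$ until all vertices are claimed. The score of the final position is the number of blue or green hyperedges all of whose vertices were claimed by Left, minus the number of red or green hyperedges all of whose vertices were claimed by Right. Left maximizes the score and Right minimizes it; $Ls(H)$ (resp. $Rs(H)$) denotes the score under optimal play when Left (resp. Right) starts. Equivalently, writing $V_F=V\setminus(V_L\cup V_R)$ for the unclaimed vertices of the position in which Left has claimed $V_L$ and Right has claimed $V_R$, one has $Ls(H)=Ls(H,\emptyset,\emptyset)$ and $Rs(H)=Rs(H,\emptyset,\emptyset)$, where, if $V_F\neq\emptyset$, $$Ls(H,V_L,V_R)=\max_{x\in V_F}Rs(H,V_L\cup\{x\},V_R),\qquad Rs(H,V_L,V_R)=\min_{x\in V_F}Ls(H,V_L,V_R\cup\{x\}),$$ and both are equal to the score of the final position if $V_F=\emptyset$. Let $P^L_n$ (resp. $P^R_n$) be the path with $n$ vertices, viewed as a hypergraph whose hyperedges are its $n-1$ edges, all colored blue (resp. all colored red). (The game on $P^L_n$ is Maker-Breaker Incidence on the path: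 the score is the number of edges of the subgraph induced by the vertices claimed by Left.) **Corollary.** Let $n\ge 1$ be an integer and write $n=5q+r$ with integers $q \ge 0$ and $0\le r\le 4$. Then $$Ls(P^L_n)=-Rs(P^R_n)=\begin{cases} q & \text{if } 0\le r\le 2,\\ q+1 & \text{if } 3\le r\le 4,\end{cases}\qquad Rs(P^L_n)=-Ls(P^R_n)=\begin{cases} q-1 & \text{if } r=0,\\ q & \text{if } 1\le r\le 4.\end{cases}$$ -/

import Mathlib

namespace ScoringGame

/-- The two players. -/
inductive Player
  | left
  | right

/-- Colors of hyperedges: Left can score the blue ones, Right the red ones, both players the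
green ones. -/
inductive EdgeColor
  | blue
  | red
  | green
  deriving DecidableEq

/-- The board of a partisan scoring positional game with vertex set `V`: a hypergraph (repeated
hyperedges are allowed) each of whose hyperedges carries a color. -/
structure ColoredHypergraph (V : Type*) where
  edges : Multiset (EdgeColor × Finset V)

namespace ColoredHypergraph

variable {V : Type*} [Fintype V] [DecidableEq V]

/-- The number of points of Left when she has claimed the vertices of `VL`: the number of blue or
green hyperedges contained in `VL`. -/
def leftPoints (H : ColoredHypergraph V) (VL : Finset V) : ℕ :=
  (H.edges.filter fun e => (e.1 = EdgeColor.blue ∨ e.1 = EdgeColor.green) ∧ e.2 ⊆ VL).card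

/-- The number of points of Right when he has claimed the vertices of `VR`: the number of red or
green hyperedges contained in `VR`. -/
def rightPoints (H : ColoredHypergraph V) (VR : Finset V) : ℕ :=
  (H.edges.filter fun e => (e.1 = EdgeColor.red ∨ e.1 = EdgeColor.green) ∧ e.2 ⊆ VR).card

/-- The vertices claimed by nobody. -/
def free (VL VR : Finset V) : Finset V := Finset.univ \ (VL ∪ VR)

/-- A move of Left makes the set of free vertices smaller. -/
theorem card_free_insert_left {VL VR : Finset V} {x : V} (hx : x ∈ free VL VR) :
    (free (insert x VL) VR).card < (free VL VR).card := by
  refine Finset.card_lt_card ⟨fun y hy => ?_, fun h => ?_⟩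
  · simp only [free, Finset.mem_sdiff, Finset.mem_univ, Finset.mem_union,
      Finset.mem_insert, true_and] at hy ⊢
    tauto
  · have := h hx
    simp [free] at this

/-- A move of Right makes the set of free vertices smaller. -/
theorem card_free_insert_right {VL VR : Finset V} {x : V} (hx : x ∈ free VL VR) :
    (free VL (insert x VR)).card < (free VL VR).card := by
  refine Finset.card_lt_card ⟨fun y hy => ?_, fun h => ?_⟩
  · simp only [free, Finset.mem_sdiff, Finset.mem_univ, Finset.mem_union,
      Finset.mem_insert, true_and] at hy ⊢
    tauto
  · have := h hx
    simp [free] at this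

/-- The score, under optimal play, of the position in which Left has claimed `VL`, Right has
claimed `VR`, and the given player moves next. Players alternately claim a free vertex until all
vertices are claimed; the score is then the number of points of Left minus the number of points of
Right. Left maximizes the score, Right minimizes it. -/
def score (H : ColoredHypergraph V) (p : Player) (VL VR : Finset V) : ℤ :=
  if h : (free VL VR).Nonempty then
    match p with
    | Player.left =>
        (free VL VR).attach.sup' h.attach
          fun x => score H Player.right (insert x.1 VL) VR
    | Player.right =>
        (free VL VR).attach.inf' h.attach
          fun x => score H Player.left VL (insert x.1 VR)
  else (H.leftPoints VL : ℤ) - (H.rightPoints VR : ℤ)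
termination_by (free VL VR).card
decreasing_by
  · exact card_free_insert_left x.2
  · exact card_free_insert_right x.2

/-- The Left score: the score of the game, from the empty position, when Left starts. -/
def Ls (H : ColoredHypergraph V) : ℤ := H.score Player.left ∅ ∅

/-- The Right score: the score of the game, from the empty position, when Right starts. -/
def Rs (H : ColoredHypergraph V) : ℤ := H.score Player.right ∅ ∅

end ColoredHypergraph

/-- The board of the game Incidence on a simple graph all of whose edges have color `c`: the
hyperedges are the pairs of endpoints of the edges. With all edges blue this is Maker-Breaker
Incidence with Left as Maker. -/
noncomputable def incidence {V : Type*} [DecidableEq V] [Fintype V] (G : SimpleGraph V)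
    (c : EdgeColor) : ColoredHypergraph V where
  edges := (Set.toFinite G.edgeSet).toFinset.val.map fun e => (c, e.toFinset)

/-- The path with `n` vertices, all of whose edges are blue. -/
noncomputable def pathL (n : ℕ) : ColoredHypergraph (Fin n) :=
  incidence (SimpleGraph.pathGraph n) EdgeColor.blue

/-- The path with `n` vertices, all of whose edges are red. -/
noncomputable def pathR (n : ℕ) : ColoredHypergraph (Fin n) :=
  incidence (SimpleGraph.pathGraph n) EdgeColor.red

end ScoringGame

/-!
A position on the path splits into independent segments. A segment `(m, b, c)` is a maximal run of
`m` free vertices between two vertices that are already claimed; `b` and `c` tell whether Left owns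
the vertex at the left and at the right end. An end of the path counts as owned by Right, since
neither lets Left score an edge there. Two adjacent claimed vertices bound a segment with `m = 0`,
worth one point if Left owns both. A move inside a segment cuts it in two, the two new ends being
owned by the player who moved.

In the sense of Milnor's theory of hot games, every segment but one is a game that becomes a dyadic
number when cooled by one point: for instance the segment of three free vertices between vertices
of Right is `{1 | 0}`, which cools to `1 / 2`. The exception is the segment `(1, true, true)`, the
switch `{2 | 0}`, which cools to `1 + *` and is called a star here. The function `weight` is eight
times this number; up to finitely many exceptions it grows by `8` when `m` grows by `5`. A sum of
segments with total weight `W` has score `⌈W / 8⌉` when Left starts and `⌊W / 8⌋` when Right starts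
if the number of stars is even, and `⌊W / 8⌋ + 1` and `⌈W / 8⌉ - 1` if it is odd
(`leftValue`, `rightValue`).

These formulas are proved directly, by induction on the number of free vertices (`score_pathL`).
No move of Left raises the weight by more than `8`, and a move raising it by exactly `8` changes
the parity of the number of stars (`left_move_gain`); this bounds every move of Left. Conversely,
if `g` is the gcd of `8` and the weight of a nonempty segment, Left has a move there that raises
the weight by at least `8 - g`, or, if `g = 8`, possibly by `8` with a change of parity
(`exists_good_left_move`). An optimal move is to play on a star if their number is odd, and
otherwise such a move in a segment for which `g` is minimal: then `g` divides `W`, so the rounding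
absorbs the loss. The moves of Right are dealt with in the mirrored way. By periodicity all claims
about single segments reduce to finitely many cases.

The path on `n` vertices is the single segment `(n, false, false)`, so its scores are the roundings
of `weightFree n / 8`. The red path is the blue path with the roles of the players exchanged.
-/

namespace ScoringGame

/-! ### Weights of segments -/

/-- Eight times the cooled value of a segment of `m` free vertices with no end owned by Left. -/
def weightFree : ℕ → ℤ
  | 0 => 0 | 1 => 0 | 2 => 0 | 3 => 4 | 4 => 4 | 5 => 6 | 6 => 8 | 7 => 8
  | m + 8 => weightFree (m + 3) + 8

/-- Eight times the cooled value of a segment of `m` free vertices with exactly one end owned by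
Left. -/
def weightHalf : ℕ → ℤ
  | 0 => 0 | 1 => 4 | 2 => 6 | 3 => 7 | 4 => 8 | 5 => 10 | 6 => 12 | 7 => 14
  | m + 8 => weightHalf (m + 3) + 8

/-- Eight times the cooled value of a segment of `m` free vertices with both ends owned by Left. For
`m = 1` the cooled value is `1 + *`, of which only the number `1` is recorded here; the summand `*`
is recorded by `star`. -/
def weightOwned : ℕ → ℤ
  | 0 => 8 | 1 => 8 | 2 => 8 | 3 => 12 | 4 => 14 | 5 => 15 | 6 => 16 | 7 => 18
  | m + 8 => weightOwned (m + 3) + 8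

/-- The weight of the segment of `m` free vertices whose ends are owned by Left or not, as the two
Booleans tell. -/
def weight : ℕ → Bool → Bool → ℤ
  | m, false, false => weightFree m
  | m, true, true => weightOwned m
  | m, _, _ => weightHalf m

/-- The number of stars (zero or one) of a segment: a single free vertex between two vertices of
Left is the only star. -/
def star : ℕ → Bool → Bool → ℤ
  | 1, true, true => 1
  | _, _, _ => 0

theorem weight_add_eight (m : ℕ) (b c : Bool) : weight (m + 8) b c = weight (m + 3) b c + 8 := by
  cases b <;> cases c <;> rfl

theorem star_add_two (m : ℕ) (b c : Bool) : star (m + 2) b c = 0 := rfl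

/-- Induction with period five in each of two variables, where periodicity starts at `3`. -/
theorem periodic_induction {P : ℕ → ℕ → Prop} (base : ∀ i < 8, ∀ j < 8, P i j)
    (left : ∀ i j, P (i + 3) j → P (i + 8) j) (right : ∀ i j, P i (j + 3) → P i (j + 8)) :
    ∀ i j, P i j := by
  intro i
  induction i using Nat.strong_induction_on with
  | _ i ih =>
    intro j
    by_cases hi : i < 8
    · induction j using Nat.strong_induction_on with
      | _ j ihj =>
        by_cases hj : j < 8
        · exact base i hi j hj
        · obtain ⟨k, rfl⟩ := Nat.exists_eq_add_of_le' (not_lt.mp hj)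
          exact right i k (ihj (k + 3) (by omega))
    · obtain ⟨k, rfl⟩ := Nat.exists_eq_add_of_le' (not_lt.mp hi)
      exact left k j (ih (k + 3) (by omega) j)

/-- A move of Left in a segment raises its weight by at most `8`, and by exactly `8` only if it
changes the parity of the number of stars. -/
theorem left_move_gain (b c : Bool) (i j : ℕ) :
    weight i b true + weight j true c ≤ weight (i + j + 1) b c + 8 ∧
    (weight i b true + weight j true c ≤ weight (i + j + 1) b c + 7 ∨
      (star i b true + star j true c - star (i + j + 1) b c) % 2 = 1) := by
  revert i j
  apply periodic_induction
  · cases b <;> cases c <;> decide +kernel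
  · intro i j h
    rw [show i + 8 + j + 1 = i + j + 1 + 8 by omega, weight_add_eight, weight_add_eight]
    rw [show i + 3 + j + 1 = i + j + 1 + 3 by omega] at h
    simp only [star_add_two] at h ⊢
    omega
  · intro i j h
    rw [show i + (j + 8) + 1 = i + j + 1 + 8 by omega, weight_add_eight, weight_add_eight]
    rw [show i + (j + 3) + 1 = i + j + 1 + 3 by omega] at h
    simp only [star_add_two] at h ⊢
    omega

/-- A move of Right in a segment lowers its weight by at most `8`, and by exactly `8` only if it
changes the parity of the number of stars. -/
theorem right_move_gain (b c : Bool) (i j : ℕ) :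
    weight (i + j + 1) b c ≤ weight i b false + weight j false c + 8 ∧
    (weight (i + j + 1) b c ≤ weight i b false + weight j false c + 7 ∨
      (star i b false + star j false c - star (i + j + 1) b c) % 2 = 1) := by
  revert i j
  apply periodic_induction
  · cases b <;> cases c <;> decide +kernel
  · intro i j h
    rw [show i + 8 + j + 1 = i + j + 1 + 8 by omega, weight_add_eight, weight_add_eight]
    rw [show i + 3 + j + 1 = i + j + 1 + 3 by omega] at h
    simp only [star_add_two] at h ⊢
    omega
  · intro i j h
    rw [show i + (j + 8) + 1 = i + j + 1 + 8 by omega, weight_add_eight, weight_add_eight]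
    rw [show i + (j + 3) + 1 = i + j + 1 + 3 by omega] at h
    simp only [star_add_two] at h ⊢
    omega

/-- If `P` persists when one of its arguments grows by five, from `4` on, then every `m` has a
splitting `m = i + j` with `P i j` as soon as the numbers below `12` have one: a splitting of a
number that is at least `7` has a part that is at least `4`. -/
theorem exists_split_of_periodic {P : ℕ → ℕ → Prop} (base : ∀ m < 12, ∃ i ≤ m, P i (m - i))
    (left : ∀ i j, P (i + 4) j → P (i + 9) j) (right : ∀ i j, P i (j + 4) → P i (j + 9)) (m : ℕ) :
    ∃ i j, i + j = m ∧ P i j := by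
  induction m using Nat.strong_induction_on with
  | _ m ih =>
    by_cases hm : m < 12
    · obtain ⟨i, hi, h⟩ := base m hm
      exact ⟨i, m - i, by omega, h⟩
    · obtain ⟨i, j, hij, h⟩ := ih (m - 5) (by omega)
      rcases le_or_gt 4 i with hi | hi
      · obtain ⟨k, rfl⟩ := Nat.exists_eq_add_of_le' hi
        exact ⟨k + 9, j, by omega, left k j h⟩
      · obtain ⟨k, rfl⟩ := Nat.exists_eq_add_of_le' (show 4 ≤ j by omega)
        exact ⟨i, k + 9, by omega, right i k h⟩

/-- Every nonempty segment has a move of Left that keeps the parity of stars and loses at most the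
granularity `gcd (weight, 8)` against the ideal gain of `8`, or changes the parity and gains `8`. The
second alternative is needed for the segments with one or two free vertices between vertices of
Left. -/
theorem exists_good_left_move (b c : Bool) (m : ℕ) : ∃ i j, i + j = m ∧
    (((star i b true + star j true c - star (i + j + 1) b c) % 2 = 0 ∧
      weight (i + j + 1) b c + 8 ≤
        weight i b true + weight j true c + (weight (i + j + 1) b c).gcd 8) ∨
    ((star i b true + star j true c - star (i + j + 1) b c) % 2 = 1 ∧
      (weight (i + j + 1) b c).gcd 8 = 8 ∧
      weight (i + j + 1) b c + 8 ≤ weight i b true + weight j true c)) := by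
  apply exists_split_of_periodic
  · cases b <;> cases c <;> decide +kernel
  · intro i j h
    rw [show i + 9 = i + 1 + 8 by omega, show i + 1 + 8 + j + 1 = i + j + 2 + 8 by omega,
      weight_add_eight, weight_add_eight, Int.gcd_add_self_left]
    rw [show i + 4 = i + 1 + 3 by omega, show i + 1 + 3 + j + 1 = i + j + 2 + 3 by omega] at h
    simp only [star_add_two] at h ⊢
    omega
  · intro i j h
    rw [show j + 9 = j + 1 + 8 by omega, show i + (j + 1 + 8) + 1 = i + j + 2 + 8 by omega,
      weight_add_eight, weight_add_eight, Int.gcd_add_self_left]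
    rw [show j + 4 = j + 1 + 3 by omega, show i + (j + 1 + 3) + 1 = i + j + 2 + 3 by omega] at h
    simp only [star_add_two] at h ⊢
    omega

/-- The counterpart of `exists_good_left_move` for Right, who lowers the weight. -/
theorem exists_good_right_move (b c : Bool) (m : ℕ) : ∃ i j, i + j = m ∧
    (((star i b false + star j false c - star (i + j + 1) b c) % 2 = 0 ∧
      weight i b false + weight j false c + 8 ≤
        weight (i + j + 1) b c + (weight (i + j + 1) b c).gcd 8) ∨
    ((star i b false + star j false c - star (i + j + 1) b c) % 2 = 1 ∧
      (weight (i + j + 1) b c).gcd 8 = 8 ∧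
      weight i b false + weight j false c + 8 ≤ weight (i + j + 1) b c)) := by
  apply exists_split_of_periodic
  · cases b <;> cases c <;> decide +kernel
  · intro i j h
    rw [show i + 9 = i + 1 + 8 by omega, show i + 1 + 8 + j + 1 = i + j + 2 + 8 by omega,
      weight_add_eight, weight_add_eight, Int.gcd_add_self_left]
    rw [show i + 4 = i + 1 + 3 by omega, show i + 1 + 3 + j + 1 = i + j + 2 + 3 by omega] at h
    simp only [star_add_two] at h ⊢
    omega
  · intro i j h
    rw [show j + 9 = j + 1 + 8 by omega, show i + (j + 1 + 8) + 1 = i + j + 2 + 8 by omega,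
      weight_add_eight, weight_add_eight, Int.gcd_add_self_left]
    rw [show j + 4 = j + 1 + 3 by omega, show i + (j + 1 + 3) + 1 = i + j + 2 + 3 by omega] at h
    simp only [star_add_two] at h ⊢
    omega

/-! ### Sums of segments -/

/-- The weight of a position, given as the list of its segments. -/
def totalWeight (l : List (ℕ × Bool × Bool)) : ℤ := (l.map fun s => weight s.1 s.2.1 s.2.2).sum

/-- The number of stars of a position, given as the list of its segments. -/
def starCount (l : List (ℕ × Bool × Bool)) : ℤ := (l.map fun s => star s.1 s.2.1 s.2.2).sum

/-- The score of a sum of segments when Left moves next. -/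
def leftValue (l : List (ℕ × Bool × Bool)) : ℤ :=
  if starCount l % 2 = 0 then (totalWeight l + 7) / 8 else totalWeight l / 8 + 1

/-- The score of a sum of segments when Right moves next. -/
def rightValue (l : List (ℕ × Bool × Bool)) : ℤ :=
  if starCount l % 2 = 0 then totalWeight l / 8 else (totalWeight l + 7) / 8 - 1

theorem rightValue_le_leftValue_of_left_move (P Q : List (ℕ × Bool × Bool)) (i j : ℕ)
    (b c : Bool) :
    rightValue (P ++ (i, b, true) :: (j, true, c) :: Q) ≤
      leftValue (P ++ (i + j + 1, b, c) :: Q) := by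
  have h := left_move_gain b c i j
  simp only [rightValue, leftValue, totalWeight, starCount, List.map_append, List.map_cons,
    List.sum_append, List.sum_cons]
  split_ifs <;> omega

theorem rightValue_le_leftValue_of_right_move (P Q : List (ℕ × Bool × Bool)) (i j : ℕ)
    (b c : Bool) :
    rightValue (P ++ (i + j + 1, b, c) :: Q) ≤
      leftValue (P ++ (i, b, false) :: (j, false, c) :: Q) := by
  have h := right_move_gain b c i j
  simp only [rightValue, leftValue, totalWeight, starCount, List.map_append, List.map_cons,
    List.sum_append, List.sum_cons]
  split_ifs <;> omega

theorem gcd_eight_cases (w : ℤ) :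
    w.gcd 8 = 1 ∨ w.gcd 8 = 2 ∨ w.gcd 8 = 4 ∨ w.gcd 8 = 8 := by
  have h : w.gcd 8 ∈ Nat.divisors 8 := by
    simpa using (Int.gcd_dvd_natAbs_right w 8)
  rw [show Nat.divisors 8 = {1, 2, 4, 8} by decide] at h
  simpa using h

theorem gcd_weight_zero (b c : Bool) : (weight 0 b c).gcd 8 = 8 := by
  cases b <;> cases c <;> decide

/-- If the gcd of `8` and the weight of a nonempty segment is as small as possible, it divides the
total weight, because the possible gcds form a chain of divisors. -/
theorem exists_finest_segment {l : List (ℕ × Bool × Bool)} (hl : ∃ s ∈ l, 0 < s.1) :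
    ∃ P m b c Q, l = P ++ (m + 1, b, c) :: Q ∧
      (((weight (m + 1) b c).gcd 8 : ℕ) : ℤ) ∣ totalWeight l := by
  obtain ⟨t, ht, hmin⟩ := Finset.exists_min_image (l.toFinset.filter fun s => 0 < s.1)
    (fun s => (weight s.1 s.2.1 s.2.2).gcd 8) (by
      obtain ⟨s, hs, h⟩ := hl
      exact ⟨s, by simp [hs, h]⟩)
  obtain ⟨m, b, c⟩ := t
  simp only [Finset.mem_filter, List.mem_toFinset] at ht
  obtain ⟨k, rfl⟩ := Nat.exists_eq_add_of_le' (show 1 ≤ m from ht.2)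
  obtain ⟨P, Q, hPQ⟩ := List.append_of_mem ht.1
  refine ⟨P, k, b, c, Q, hPQ, List.dvd_sum fun w hw => ?_⟩
  obtain ⟨s, hs, rfl⟩ := List.mem_map.mp hw
  have hdvd : (weight (k + 1) b c).gcd 8 ∣ (weight s.1 s.2.1 s.2.2).gcd 8 := by
    have hle : (weight (k + 1) b c).gcd 8 ≤ (weight s.1 s.2.1 s.2.2).gcd 8 := by
      rcases Nat.eq_zero_or_pos s.1 with h0 | h0
      · rw [h0, gcd_weight_zero]
        have := gcd_eight_cases (weight (k + 1) b c)
        omega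
      · exact hmin s (by simp [hs, h0])
    -- both numbers lie in `{1, 2, 4, 8}`, where `≤` and `∣` agree
    rcases gcd_eight_cases (weight (k + 1) b c) with h | h | h | h <;>
      rcases gcd_eight_cases (weight s.1 s.2.1 s.2.2) with h' | h' | h' | h' <;>
      rw [h, h'] at hle ⊢ <;> revert hle <;> decide
  exact (Int.natCast_dvd_natCast.mpr hdvd).trans (Int.gcd_dvd_left _ _)

theorem exists_star_of_starCount_odd {l : List (ℕ × Bool × Bool)} (hl : starCount l % 2 ≠ 0) :
    (1, true, true) ∈ l := by
  by_contra hmem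
  apply hl
  have h0 : starCount l = 0 := List.sum_eq_zero fun w hw => by
    obtain ⟨⟨m, b, c⟩, hs, rfl⟩ := List.mem_map.mp hw
    unfold star
    split
    · next h1 h2 h3 =>
      simp only at h1 h2 h3
      subst h1 h2 h3
      exact absurd hs hmem
    · rfl
  simp [h0]

theorem exists_left_move_leftValue_le {l : List (ℕ × Bool × Bool)} (hl : ∃ s ∈ l, 0 < s.1) :
    ∃ P i j b c Q, l = P ++ (i + j + 1, b, c) :: Q ∧
      leftValue l ≤ rightValue (P ++ (i, b, true) :: (j, true, c) :: Q) := by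
  by_cases hodd : starCount l % 2 = 0
  · obtain ⟨P, m, b, c, Q, rfl, hdvd⟩ := exists_finest_segment hl
    obtain ⟨i, j, rfl, h⟩ := exists_good_left_move b c m
    refine ⟨P, i, j, b, c, Q, rfl, ?_⟩
    have hg := gcd_eight_cases (weight (i + j + 1) b c)
    generalize (weight (i + j + 1) b c).gcd 8 = g at hdvd h hg
    simp only [rightValue, leftValue, totalWeight, starCount, List.map_append, List.map_cons,
      List.sum_append, List.sum_cons] at hodd hdvd ⊢
    rw [if_pos hodd]
    rcases hg with rfl | rfl | rfl | rfl <;> split_ifs <;> omega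
  -- with an odd number of stars, the move is on a star
  · obtain ⟨P, Q, rfl⟩ := List.append_of_mem (exists_star_of_starCount_odd hodd)
    refine ⟨P, 0, 0, true, true, Q, rfl, ?_⟩
    simp only [rightValue, leftValue, totalWeight, starCount, List.map_append, List.map_cons,
      List.sum_append, List.sum_cons, weight, star, weightOwned] at hodd ⊢
    rw [if_neg hodd]
    split_ifs <;> omega

theorem exists_right_move_le_rightValue {l : List (ℕ × Bool × Bool)} (hl : ∃ s ∈ l, 0 < s.1) :
    ∃ P i j b c Q, l = P ++ (i + j + 1, b, c) :: Q ∧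
      leftValue (P ++ (i, b, false) :: (j, false, c) :: Q) ≤ rightValue l := by
  by_cases hodd : starCount l % 2 = 0
  · obtain ⟨P, m, b, c, Q, rfl, hdvd⟩ := exists_finest_segment hl
    obtain ⟨i, j, rfl, h⟩ := exists_good_right_move b c m
    refine ⟨P, i, j, b, c, Q, rfl, ?_⟩
    have hg := gcd_eight_cases (weight (i + j + 1) b c)
    generalize (weight (i + j + 1) b c).gcd 8 = g at hdvd h hg
    simp only [rightValue, leftValue, totalWeight, starCount, List.map_append, List.map_cons,
      List.sum_append, List.sum_cons] at hodd hdvd ⊢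
    rw [if_pos hodd]
    rcases hg with rfl | rfl | rfl | rfl <;> split_ifs <;> omega
  -- with an odd number of stars, the move is on a star
  · obtain ⟨P, Q, rfl⟩ := List.append_of_mem (exists_star_of_starCount_odd hodd)
    refine ⟨P, 0, 0, true, true, Q, rfl, ?_⟩
    simp only [rightValue, leftValue, totalWeight, starCount, List.map_append, List.map_cons,
      List.sum_append, List.sum_cons, weight, star, weightOwned, weightHalf] at hodd ⊢
    rw [if_neg hodd]
    split_ifs <;> omega

/-! ### Words and their segments -/

/-- The list of segments of a word, where `none` is a free vertex, `some true` a vertex of Left and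
`some false` a vertex of Right. The word is read behind an end with owner `b` and `k` free vertices;
its right end counts as owned by Right. -/
def segments : Bool → ℕ → List (Option Bool) → List (ℕ × Bool × Bool)
  | b, k, [] => [(k, b, false)]
  | b, k, none :: w => segments b (k + 1) w
  | b, k, some x :: w => (k, b, x) :: segments x 0 w

theorem segments_replicate_append (b : Bool) (k m : ℕ) (w : List (Option Bool)) :
    segments b k (List.replicate m none ++ w) = segments b (k + m) w := by
  induction m generalizing k with
  | zero => rfl
  | succ m ih =>
    rw [List.replicate_succ, List.cons_append, segments, ih, Nat.add_right_comm, Nat.add_assoc]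

/-- Only the first segment of a word depends on what precedes the word, and it does so by the left
end and the number of preceding free vertices alone. -/
theorem exists_segments_eq_cons (w : List (Option Bool)) :
    ∃ j c Q, ∀ b k, segments b k w = (k + j, b, c) :: Q := by
  induction w with
  | nil => exact ⟨0, false, [], fun b k => rfl⟩
  | cons x w ih =>
    cases x with
    | none =>
      obtain ⟨j, c, Q, h⟩ := ih
      refine ⟨j + 1, c, Q, fun b k => ?_⟩
      rw [segments, h, Nat.add_right_comm, Nat.add_assoc]
    | some x => exact ⟨0, x, segments x 0 w, fun b k => rfl⟩

/-- Claiming a free vertex of a word cuts one of the segments in two. -/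
theorem segments_move (b : Bool) (k : ℕ) (u v : List (Option Bool)) :
    ∃ P i j b' c Q, segments b k (u ++ none :: v) = P ++ (i + j + 1, b', c) :: Q ∧
      ∀ x, segments b k (u ++ some x :: v) = P ++ (i, b', x) :: (j, x, c) :: Q := by
  induction u generalizing b k with
  | nil =>
    obtain ⟨j, c, Q, h⟩ := exists_segments_eq_cons v
    refine ⟨[], k, j, b, c, Q, ?_, fun x => ?_⟩
    · simp only [List.nil_append, segments, h]
      rw [Nat.add_right_comm]
    · simp only [List.nil_append, segments, h, Nat.zero_add]
  | cons y u ih =>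
    cases y with
    | none => exact ih b (k + 1)
    | some y =>
      obtain ⟨P, i, j, b', c, Q, h, h'⟩ := ih y 0
      exact ⟨(k, b, y) :: P, i, j, b', c, Q, by simp [segments, h], fun x => by
        simp [segments, h' x]⟩

/-- Every way of cutting a segment in two comes from claiming a free vertex of the word. -/
theorem exists_move_of_segments_eq {b : Bool} {k : ℕ} {w : List (Option Bool)}
    {P Q : List (ℕ × Bool × Bool)} {i j : ℕ} {b' c : Bool}
    (h : segments b k w = P ++ (i + j + 1, b', c) :: Q) :
    ∃ u v, List.replicate k none ++ w = u ++ none :: v ∧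
      ∀ x, segments b 0 (u ++ some x :: v) = P ++ (i, b', x) :: (j, x, c) :: Q := by
  have hsplit : ∀ z : List (Option Bool), List.replicate (i + j + 1) none ++ z =
      List.replicate i none ++ none :: (List.replicate j none ++ z) := fun z => by
    rw [Nat.add_assoc, List.replicate_add, List.replicate_succ]
    simp
  induction w generalizing b k P with
  | nil =>
    cases P with
    | nil =>
      simp only [segments, List.nil_append, List.cons.injEq, Prod.mk.injEq] at h
      obtain ⟨⟨rfl, rfl, rfl⟩, rfl⟩ := h
      refine ⟨_, _, hsplit [], fun x => ?_⟩
      simp only [segments_replicate_append, segments, Nat.zero_add, List.nil_append]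
    | cons p P => simp [segments] at h
  | cons y w ih =>
    cases y with
    | none =>
      obtain ⟨u, v, huv, h'⟩ := ih h
      refine ⟨u, v, ?_, h'⟩
      rw [← huv, List.replicate_succ', List.append_assoc]
      rfl
    | some y =>
      cases P with
      | nil =>
        simp only [segments, List.nil_append, List.cons.injEq, Prod.mk.injEq] at h
        obtain ⟨⟨rfl, rfl, rfl⟩, rfl⟩ := h
        refine ⟨_, _, hsplit _, fun x => ?_⟩
        simp only [segments_replicate_append, segments, Nat.zero_add, List.nil_append]
      | cons p P =>
        simp only [segments, List.cons_append, List.cons.injEq] at h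
        obtain ⟨rfl, h⟩ := h
        obtain ⟨u, v, huv, h'⟩ := ih h
        simp only [List.replicate_zero, List.nil_append] at huv
        refine ⟨List.replicate k none ++ some y :: u, v, by simp [huv], fun x => ?_⟩
        simp only [List.append_assoc, segments_replicate_append, List.cons_append, segments, h',
          Nat.zero_add]

theorem exists_segment_pos {b : Bool} {k : ℕ} {w : List (Option Bool)} (h : none ∈ w) :
    ∃ s ∈ segments b k w, 0 < s.1 := by
  obtain ⟨u, v, rfl⟩ := List.append_of_mem h
  obtain ⟨P, i, j, b', c, Q, h, -⟩ := segments_move b k u v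
  exact ⟨_, h ▸ List.mem_append_right _ List.mem_cons_self, Nat.succ_pos _⟩

/-! ### Scores and exchange of the players -/
namespace ColoredHypergraph

section Score

variable {V : Type*} [Fintype V] [DecidableEq V]

theorem score_of_free_eq_empty (H : ColoredHypergraph V) (p : Player) {VL VR : Finset V}
    (h : free VL VR = ∅) : H.score p VL VR = (H.leftPoints VL : ℤ) - H.rightPoints VR := by
  rw [score, dif_neg (by simp [h])]

theorem score_left_le_iff (H : ColoredHypergraph V) {VL VR : Finset V}
    (h : (free VL VR).Nonempty) {a : ℤ} : H.score Player.left VL VR ≤ a ↔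
      ∀ x ∈ free VL VR, H.score Player.right (insert x VL) VR ≤ a := by
  rw [score, dif_pos h]
  simp

theorem le_score_left_iff (H : ColoredHypergraph V) {VL VR : Finset V}
    (h : (free VL VR).Nonempty) {a : ℤ} : a ≤ H.score Player.left VL VR ↔
      ∃ x ∈ free VL VR, a ≤ H.score Player.right (insert x VL) VR := by
  rw [score, dif_pos h]
  simp

theorem score_right_le_iff (H : ColoredHypergraph V) {VL VR : Finset V}
    (h : (free VL VR).Nonempty) {a : ℤ} : H.score Player.right VL VR ≤ a ↔
      ∃ x ∈ free VL VR, H.score Player.left VL (insert x VR) ≤ a := by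
  rw [score, dif_pos h]
  simp

theorem le_score_right_iff (H : ColoredHypergraph V) {VL VR : Finset V}
    (h : (free VL VR).Nonempty) {a : ℤ} : a ≤ H.score Player.right VL VR ↔
      ∀ x ∈ free VL VR, a ≤ H.score Player.left VL (insert x VR) := by
  rw [score, dif_pos h]
  simp

theorem free_comm (VL VR : Finset V) : free VL VR = free VR VL := by
  rw [free, free, Finset.union_comm]

/-- If the two players exchange their points, the score changes its sign and the roles of the players
are exchanged. -/
theorem score_eq_neg_of_points_swap {H H' : ColoredHypergraph V}
    (hl : ∀ A, H'.leftPoints A = H.rightPoints A) (hr : ∀ A, H'.rightPoints A = H.leftPoints A)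
    (VL VR : Finset V) :
    H'.score Player.left VL VR = -H.score Player.right VR VL ∧
      H'.score Player.right VL VR = -H.score Player.left VR VL := by
  induction hk : (free VL VR).card using Nat.strong_induction_on generalizing VL VR with
  | _ k ih =>
    subst hk
    rcases (free VL VR).eq_empty_or_nonempty with h | h
    · have h' := h
      rw [free_comm] at h'
      simp [score_of_free_eq_empty _ _ h, score_of_free_eq_empty _ _ h', hl, hr]
    · have h' := h
      rw [free_comm] at h'
      refine ⟨eq_of_forall_le_iff fun a => ?_, eq_of_forall_le_iff fun a => ?_⟩
      · rw [le_neg, le_score_left_iff _ h, score_right_le_iff _ h', free_comm VR VL]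
        refine exists_congr fun x => and_congr_right fun hx => ?_
        rw [(ih _ (card_free_insert_left hx) _ _ rfl).2, le_neg]
      · rw [le_neg, le_score_right_iff _ h, score_left_le_iff _ h', free_comm VR VL]
        refine forall₂_congr fun x hx => ?_
        rw [(ih _ (card_free_insert_right hx) _ _ rfl).1, le_neg]

end Score

end ColoredHypergraph

open ColoredHypergraph

/-! ### Positions on the path -/

section Board

variable {n : ℕ}

/-- The word of a position on the path: `some true` for a vertex of Left, `some false` for a vertex of
Right, `none` for a free vertex. -/
def board (VL VR : Finset (Fin n)) : List (Option Bool) :=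
  List.ofFn fun i => if i ∈ VL then some true else if i ∈ VR then some false else none

theorem mem_free_iff {VL VR : Finset (Fin n)} {x : Fin n} :
    x ∈ free VL VR ↔ x ∉ VL ∧ x ∉ VR := by
  simp [free]

theorem board_insert_left {VL VR : Finset (Fin n)} (x : Fin n) :
    board (insert x VL) VR = (board VL VR).set x (some true) := by
  refine List.ext_getElem (by simp [board]) fun i h₁ h₂ => ?_
  simp only [board, List.getElem_ofFn, List.getElem_set, Finset.mem_insert, Fin.ext_iff]
  by_cases hx : i = x
  · simp [hx]
  · simp [hx, Ne.symm hx]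

theorem board_insert_right {VL VR : Finset (Fin n)} {x : Fin n} (hx : x ∈ free VL VR) :
    board VL (insert x VR) = (board VL VR).set x (some false) := by
  refine List.ext_getElem (by simp [board]) fun i h₁ h₂ => ?_
  simp only [board, List.getElem_ofFn, List.getElem_set, Finset.mem_insert, Fin.ext_iff]
  by_cases hi : i = x
  · subst hi
    simp [(mem_free_iff.mp hx).1]
  · simp [hi, Ne.symm hi]

theorem exists_board_eq_of_mem_free {VL VR : Finset (Fin n)} {x : Fin n} (hx : x ∈ free VL VR) :
    ∃ u v, board VL VR = u ++ none :: v ∧ board (insert x VL) VR = u ++ some true :: v ∧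
      board VL (insert x VR) = u ++ some false :: v := by
  have hlen : (x : ℕ) < (board VL VR).length := by simp [board]
  have hnone : (board VL VR)[(x : ℕ)] = none := by
    simp [board, (mem_free_iff.mp hx).1, (mem_free_iff.mp hx).2]
  refine ⟨(board VL VR).take x, (board VL VR).drop (x + 1), ?_, ?_, ?_⟩
  · rw [← hnone, List.getElem_cons_drop, List.take_append_drop]
  · rw [board_insert_left, List.set_eq_take_append_cons_drop, if_pos hlen]
  · rw [board_insert_right hx, List.set_eq_take_append_cons_drop, if_pos hlen]

theorem exists_mem_free_of_board_eq {VL VR : Finset (Fin n)} {u v : List (Option Bool)}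
    (h : board VL VR = u ++ none :: v) :
    ∃ x ∈ free VL VR, board (insert x VL) VR = u ++ some true :: v ∧
      board VL (insert x VR) = u ++ some false :: v := by
  have hlen : u.length < n := by
    have := congrArg List.length h
    simp only [board, List.length_ofFn, List.length_append, List.length_cons] at this
    omega
  have hx : (⟨u.length, hlen⟩ : Fin n) ∈ free VL VR := by
    have h' : (board VL VR)[u.length]? = some none := by simp [h]
    rw [mem_free_iff]
    simp only [board, List.getElem?_ofFn, hlen, dite_true, Option.some.injEq] at h'
    split_ifs at h' with h₁ h₂
    exact ⟨h₁, h₂⟩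
  refine ⟨_, hx, ?_, ?_⟩
  · rw [board_insert_left, h]
    simp
  · rw [board_insert_right hx, h]
    simp

/-- In a word without free vertices, the weight is eight times the number of pairs of neighbors that
are both owned by Left. Here `f 0` is the owner of the left end and `f (i + 1)` that of the `i`-th
letter. -/
theorem values_segments_ofFn_some (n : ℕ) (f : ℕ → Bool) :
    totalWeight (segments (f 0) 0 (List.ofFn fun i : Fin n => some (f (i + 1)))) =
      8 * ∑ i ∈ Finset.range n, (if f i = true ∧ f (i + 1) = true then 1 else 0) ∧
    starCount (segments (f 0) 0 (List.ofFn fun i : Fin n => some (f (i + 1)))) = 0 := by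
  induction n generalizing f with
  | zero => cases h : f 0 <;> simp [segments, totalWeight, starCount, weight, weightFree,
      weightHalf, star]
  | succ n ih =>
    have h := ih fun i => f (i + 1)
    simp only [totalWeight, starCount] at h ⊢
    simp only [List.ofFn_succ, segments, List.map_cons, List.sum_cons, Fin.val_succ, Fin.val_zero,
      h.1, h.2, Finset.sum_range_succ', mul_add, Nat.zero_add] at h ⊢
    cases f 0 <;> cases f 1 <;> simp [weight, weightFree, weightHalf, weightOwned, star, add_comm]

theorem pathGraph_edgeSet_toFinset (m : ℕ) (h : (SimpleGraph.pathGraph (m + 1)).edgeSet.Finite) :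
    h.toFinset = Finset.univ.image fun i : Fin m => s(i.castSucc, i.succ) := by
  ext e
  induction e using Sym2.ind with
  | _ a b =>
    simp only [Set.Finite.mem_toFinset, SimpleGraph.mem_edgeSet, SimpleGraph.pathGraph_adj,
      Finset.mem_image, Finset.mem_univ, true_and, Sym2.eq_iff, Fin.ext_iff, Fin.val_castSucc,
      Fin.val_succ]
    constructor
    · rintro (h | h)
      · exact ⟨⟨a, by omega⟩, Or.inl ⟨rfl, h⟩⟩
      · exact ⟨⟨b, by omega⟩, Or.inr ⟨rfl, h⟩⟩
    · rintro ⟨i, ⟨h₁, h₂⟩ | ⟨h₁, h₂⟩⟩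
      · exact Or.inl (by omega)
      · exact Or.inr (by omega)

theorem leftPoints_pathL (m : ℕ) (VL : Finset (Fin (m + 1))) :
    (pathL (m + 1)).leftPoints VL =
      ∑ i : Fin m, if i.castSucc ∈ VL ∧ i.succ ∈ VL then 1 else 0 := by
  have hinj : Function.Injective fun i : Fin m => s(i.castSucc, i.succ) := by
    intro i j h
    simp only [Sym2.eq_iff, Fin.ext_iff, Fin.val_castSucc, Fin.val_succ] at h
    exact Fin.ext (by omega)
  simp only [leftPoints, pathL, incidence, Multiset.filter_map, Multiset.card_map,
    pathGraph_edgeSet_toFinset]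
  rw [Finset.image_val_of_injOn hinj.injOn, Multiset.filter_map, Multiset.card_map,
    ← Finset.filter_val, Finset.card_val, Finset.card_filter]
  refine Finset.sum_congr rfl fun i _ => ?_
  congr 1
  simp [Finset.subset_iff]

theorem rightPoints_pathL (n : ℕ) (VR : Finset (Fin n)) : (pathL n).rightPoints VR = 0 := by
  simp [rightPoints, pathL, incidence, Multiset.filter_map]

theorem leftPoints_pathR (n : ℕ) (VL : Finset (Fin n)) : (pathR n).leftPoints VL = 0 := by
  simp [leftPoints, pathR, incidence, Multiset.filter_map]

theorem rightPoints_pathR (n : ℕ) (VR : Finset (Fin n)) :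
    (pathR n).rightPoints VR = (pathL n).leftPoints VR := by
  simp [leftPoints, rightPoints, pathR, pathL, incidence, Multiset.filter_map]

/-- At the end of the game, the weight is eight times the number of points of Left. -/
theorem leftPoints_pathL_eq_of_free_eq_empty (m : ℕ) {VL VR : Finset (Fin (m + 1))}
    (h : free VL VR = ∅) :
    totalWeight (segments false 0 (board VL VR)) = 8 * (pathL (m + 1)).leftPoints VL ∧
      starCount (segments false 0 (board VL VR)) = 0 := by
  -- `f 0` stands for the left end of the path, `f (i + 1)` for its `i`-th vertex
  let f : ℕ → Bool
    | 0 => false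
    | i + 1 => decide (∃ h : i < m + 1, (⟨i, h⟩ : Fin (m + 1)) ∈ VL)
  have hboard : board VL VR = List.ofFn fun i : Fin (m + 1) => some (f (i + 1)) := by
    refine congrArg List.ofFn (funext fun i => ?_)
    have hi : i ∉ free VL VR := by simp [h]
    rw [mem_free_iff, not_and_or, not_not, not_not] at hi
    by_cases h₁ : i ∈ VL
    · simp [f, h₁, i.is_le]
    · simp [f, h₁, hi.resolve_left h₁]
  have hf := values_segments_ofFn_some (m + 1) f
  rw [hboard]
  refine ⟨hf.1.trans ?_, hf.2⟩
  rw [Finset.sum_range_succ', leftPoints_pathL, Finset.sum_range]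
  push_cast
  simp only [f, false_and, if_false, add_zero, decide_eq_true_eq]
  refine congrArg _ (Finset.sum_congr rfl fun i _ => ?_)
  congr 1
  have h₁ : (i : ℕ) < m + 1 := by omega
  have h₂ : (i : ℕ) + 1 < m + 1 := by omega
  simp only [h₁, h₂, exists_true_left]
  rfl

/-- The score of every position on the blue path is given by the weight and the number of stars of
its segments. -/
theorem score_pathL (m : ℕ) (VL VR : Finset (Fin (m + 1))) :
    (pathL (m + 1)).score Player.left VL VR = leftValue (segments false 0 (board VL VR)) ∧
      (pathL (m + 1)).score Player.right VL VR = rightValue (segments false 0 (board VL VR)) := by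
  induction hk : (free VL VR).card using Nat.strong_induction_on generalizing VL VR with
  | _ k ih =>
    subst hk
    rcases (free VL VR).eq_empty_or_nonempty with h | h
    · have hw := leftPoints_pathL_eq_of_free_eq_empty m h
      rw [score_of_free_eq_empty _ _ h, score_of_free_eq_empty _ _ h, rightPoints_pathL,
        leftValue, rightValue, hw.1, hw.2]
      constructor
      · simp
        omega
      · simp
    · have hpos : ∃ s ∈ segments false 0 (board VL VR), 0 < s.1 := by
        obtain ⟨x, hx⟩ := h
        obtain ⟨u, v, huv, -⟩ := exists_board_eq_of_mem_free hx
        exact exists_segment_pos (by simp [huv])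
      refine ⟨le_antisymm ?_ ?_, le_antisymm ?_ ?_⟩
      · refine (score_left_le_iff _ h).mpr fun x hx => ?_
        rw [(ih _ (card_free_insert_left hx) _ _ rfl).2]
        obtain ⟨u, v, huv, hleft, -⟩ := exists_board_eq_of_mem_free hx
        obtain ⟨P, i, j, b, c, Q, hseg, hmove⟩ := segments_move false 0 u v
        rw [hleft, huv, hmove, hseg]
        exact rightValue_le_leftValue_of_left_move P Q i j b c
      · obtain ⟨P, i, j, b, c, Q, hseg, hle⟩ := exists_left_move_leftValue_le hpos
        obtain ⟨u, v, huv, hmove⟩ := exists_move_of_segments_eq hseg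
        obtain ⟨x, hx, hleft, -⟩ := exists_mem_free_of_board_eq huv
        refine (le_score_left_iff _ h).mpr ⟨x, hx, ?_⟩
        rwa [(ih _ (card_free_insert_left hx) _ _ rfl).2, hleft, hmove]
      · obtain ⟨P, i, j, b, c, Q, hseg, hle⟩ := exists_right_move_le_rightValue hpos
        obtain ⟨u, v, huv, hmove⟩ := exists_move_of_segments_eq hseg
        obtain ⟨x, hx, -, hright⟩ := exists_mem_free_of_board_eq huv
        refine (score_right_le_iff _ h).mpr ⟨x, hx, ?_⟩
        rwa [(ih _ (card_free_insert_right hx) _ _ rfl).1, hright, hmove]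
      · refine (le_score_right_iff _ h).mpr fun x hx => ?_
        rw [(ih _ (card_free_insert_right hx) _ _ rfl).1]
        obtain ⟨u, v, huv, -, hright⟩ := exists_board_eq_of_mem_free hx
        obtain ⟨P, i, j, b, c, Q, hseg, hmove⟩ := segments_move false 0 u v
        rw [hright, huv, hmove, hseg]
        exact rightValue_le_leftValue_of_right_move P Q i j b c

/-! ### Scores of the whole paths -/

theorem segments_board_empty (n : ℕ) :
    segments false 0 (board (∅ : Finset (Fin n)) ∅) = [(n, false, false)] := by
  have h : board (∅ : Finset (Fin n)) ∅ = List.replicate n none ++ [] := by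
    simp [board, List.ofFn_const]
  rw [h, segments_replicate_append, Nat.zero_add, segments]

theorem Ls_pathL (m : ℕ) : (pathL (m + 1)).Ls = (weightFree (m + 1) + 7) / 8 := by
  rw [Ls, (score_pathL m ∅ ∅).1, segments_board_empty]
  simp [leftValue, starCount, totalWeight, weight, star]

theorem Rs_pathL (m : ℕ) : (pathL (m + 1)).Rs = weightFree (m + 1) / 8 := by
  rw [Rs, (score_pathL m ∅ ∅).2, segments_board_empty]
  simp [rightValue, starCount, totalWeight, weight, star]

theorem Ls_pathR (n : ℕ) : (pathR n).Ls = -(pathL n).Rs :=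
  (score_eq_neg_of_points_swap (fun A => by rw [leftPoints_pathR, rightPoints_pathL])
    (rightPoints_pathR n) ∅ ∅).1

theorem Rs_pathR (n : ℕ) : (pathR n).Rs = -(pathL n).Ls :=
  (score_eq_neg_of_points_swap (fun A => by rw [leftPoints_pathR, rightPoints_pathL])
    (rightPoints_pathR n) ∅ ∅).2

theorem weightFree_five_mul_add (q r : ℕ) :
    weightFree (5 * q + r + 1) = 8 * q + weightFree (r + 1) := by
  induction q with
  | zero => simp
  | succ q ih =>
    have hstep : ∀ m, weightFree (m + 6) = weightFree (m + 1) + 8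
      | 0 => rfl
      | 1 => rfl
      | _ + 2 => rfl
    rw [show 5 * (q + 1) + r + 1 = 5 * q + r + 6 by omega, hstep, ih]
    push_cast
    ring

end Board

end ScoringGame

theorem mainTheorem4 (n q r : ℕ) (hn : 1 ≤ n) (hnqr : n = 5 * q + r) (hr : r < 5) :
    (r ≤ 2 →
      (ScoringGame.pathL n).Ls = (q : ℤ) ∧ -(ScoringGame.pathR n).Rs = (q : ℤ)) ∧
    (3 ≤ r →
      (ScoringGame.pathL n).Ls = (q : ℤ) + 1 ∧ -(ScoringGame.pathR n).Rs = (q : ℤ) + 1) ∧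
    (r = 0 →
      (ScoringGame.pathL n).Rs = (q : ℤ) - 1 ∧ -(ScoringGame.pathR n).Ls = (q : ℤ) - 1) ∧
    (1 ≤ r →
      (ScoringGame.pathL n).Rs = (q : ℤ) ∧ -(ScoringGame.pathR n).Ls = (q : ℤ)) := by
  rw [ScoringGame.Ls_pathR, ScoringGame.Rs_pathR, neg_neg, neg_neg]
  obtain ⟨m, rfl⟩ := Nat.exists_eq_add_of_le' hn
  rw [ScoringGame.Ls_pathL, ScoringGame.Rs_pathL]
  rcases Nat.eq_zero_or_pos r with rfl | hr'
  · obtain ⟨p, rfl⟩ := Nat.exists_eq_add_of_le' (show 1 ≤ q by omega)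
    rw [show m = 5 * p + 4 by omega, ScoringGame.weightFree_five_mul_add]
    simp only [ScoringGame.weightFree]
    omega
  · obtain ⟨t, rfl⟩ := Nat.exists_eq_add_of_le' hr'
    rw [show m = 5 * q + t by omega, ScoringGame.weightFree_five_mul_add]
    have ht : t < 4 := by omega
    interval_cases t <;> simp only [ScoringGame.weightFree] <;> omega
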